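/- For $(a,b)\in\mathbb R^2$ consider the infinite-horizon Fuller problem $$\tfrac12\int_0^{\infty}x^2\,dt\to\min,\qquad \dot x=y,\quad \dot y=u,\quad |u|\le 1,\qquad x(0)=a,\ y(0)=b,$$ with measurable controls $u$ (considered up to null sets), and let $T_F(a,b)\ge 0$ be the first time from which on its optimal trajectory stays at the origin. Let $(x_0,y_0),(x_1,y_1)\in\mathbb R^2$ and $t_1>0$ with $t_1\ge T_F(x_0,y_0)+T_F(x_1,-y_1)$, and consider the finite-horizon Fuller problem $$\tfrac12\int_0^{t_1}x^2\,dt\to\min,\qquad \dot x=y,\quad \dot y=u,\quad |u|\le 1,$$ $$x(0)=x_0,\quad y(0)=y_0,\quad x(t_1)=x_1,\quad y(t_1)=y_1.$$ The infinite-horizon problems starting from $(x_0,y_0)$ and from $(x_1,-y_1)$ have unique optimal trajectories $(x^0,y^0,u^0)$ and $(x^1,y^1,u^1)$, and these reach the origin and stay there from the finite times $T_F(x_0,y_0)$ and $T_F(x_1,-y_1)$ on, respectively, and from no earlier time. The finite-horizon problem has an optimal trajectory $(x_F,y_F,u_F)$; it is unique, and (with equalities of controls understood almost everywhere) * $x_F(t)=x^0(t)$,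 $y_F(t)=y^0(t)$, $u_F(t)=u^0(t)$ for $t\in[0,T_F(x_0,y_0)]$; * $x_F(t)=y_F(t)=u_F(t)=0$ for $t\in[T_F(x_0,y_0),\,t_1-T_F(x_1,-y_1)]$; * $x_F(t)=x^1(t_1-t)$, $y_F(t)=-y^1(t_1-t)$, $u_F(t)=u^1(t_1-t)$ for $t\in[t_1-T_F(x_1,-y_1),\,t_1]$. Moreover, if $(x_0,y_0)\neq(0,0)$, then $u_F$ chatters as $t\to T_F(x_0,y_0)-0$: there are switching times $s_0<s_1<\dots$ in $(0,T_F(x_0,y_0))$ converging to $T_F(x_0,y_0)$ such that $u_F$ is alternately equal to $1$ and $-1$ on the successive intervals $(s_k,s_{k+1})$. Likewise, if $(x_1,y_1)\ne(0,0)$, then $u_F$ chatters as $t\to t_1-T_F(x_1,-y_1)+0$: there are switching times $s_0>s_1>\dots$ in $(t_1-T_F(x_1,-y_1),t_1)$ converging to $t_1-T_F(x_1,-y_1)$ such that $u_F$ is alternately equal to $1$ and $-1$ on the successive intervals $(s_{k+1},s_k)$. -/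

import Mathlib

open Set Filter Topology MeasureTheory
open scoped ENNReal

namespace Fuller

/-- A triple of real functions `(x(t), y(t), u(t))`. Only the values on the time interval of the
problem under consideration matter; `u` matters only up to a null set. -/
structure Path where
  x : ℝ → ℝ
  y : ℝ → ℝ
  u : ℝ → ℝ

/-- `p` solves the control system `ẋ = y`, `ẏ = u`, `|u| ≤ 1` on the time interval `S`
(which is `[0, t₁]` or `[0, ∞)`) with `x(0) = a`, `y(0) = b`: the control `u` is measurable with
values in `[-1, 1]` almost everywhere on `S`, and `x`, `y` are the absolutely continuous solutions
of the system (in integral form). -/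
structure IsTrajectory (S : Set ℝ) (a b : ℝ) (p : Path) : Prop where
  aestronglyMeasurable : AEStronglyMeasurable p.u (volume.restrict S)
  abs_le_one : ∀ᵐ t ∂(volume.restrict S), |p.u t| ≤ 1
  x_eq : ∀ t ∈ S, p.x t = a + ∫ s in (0 : ℝ)..t, p.y s
  y_eq : ∀ t ∈ S, p.y t = b + ∫ s in (0 : ℝ)..t, p.u s

/-- Two paths coincide on `S`: `x` and `y` everywhere on `S`, the controls almost everywhere. -/
def Same (S : Set ℝ) (p q : Path) : Prop :=
  (∀ t ∈ S, p.x t = q.x t ∧ p.y t = q.y t) ∧ ∀ᵐ t ∂(volume.restrict S), p.u t = q.u t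

/-- The functional `½ ∫₀^∞ x² dt`, with values in `[0, ∞]`. -/
noncomputable def infCost (p : Path) : ℝ≥0∞ :=
  ∫⁻ t in Ici (0 : ℝ), ENNReal.ofReal (p.x t ^ 2 / 2)

/-- `p` is an optimal trajectory of the infinite-horizon (classical) Fuller problem
`½ ∫₀^∞ x² dt → min`, `ẋ = y`, `ẏ = u`, `|u| ≤ 1`, `x(0) = a`, `y(0) = b`. -/
def IsOptimal (a b : ℝ) (p : Path) : Prop :=
  IsTrajectory (Ici 0) a b p ∧ ∀ q : Path, IsTrajectory (Ici 0) a b q → infCost p ≤ infCost q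

/-- The set of times `T ≥ 0` from which on the path stays at the origin. -/
def restTimes (p : Path) : Set ℝ :=
  {T | 0 ≤ T ∧ ∀ t, T ≤ t → p.x t = 0 ∧ p.y t = 0}

/-- The time `T_F(a, b)` at which the optimal trajectory of the infinite-horizon Fuller problem
starting at `(a, b)` arrives at the origin, to stay there. -/
noncomputable def arrivalTime (a b : ℝ) : ℝ :=
  sInf {T | ∃ p : Path, IsOptimal a b p ∧ T ∈ restTimes p}

/-- `p` is admissible in the Fuller problem on `[0, t₁]` from `(x₀, y₀)` to `(x₁, y₁)`. -/
def IsAdmissibleOn (t₁ x₀ y₀ x₁ y₁ : ℝ) (p : Path) : Prop :=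
  IsTrajectory (Icc 0 t₁) x₀ y₀ p ∧ p.x t₁ = x₁ ∧ p.y t₁ = y₁

/-- `p` is an optimal trajectory of the finite-horizon Fuller problem `½ ∫₀^{t₁} x² dt → min`,
`ẋ = y`, `ẏ = u`, `|u| ≤ 1`, `(x, y)(0) = (x₀, y₀)`, `(x, y)(t₁) = (x₁, y₁)`. -/
def IsOptimalOn (t₁ x₀ y₀ x₁ y₁ : ℝ) (p : Path) : Prop :=
  IsAdmissibleOn t₁ x₀ y₀ x₁ y₁ p ∧
    ∀ q : Path, IsAdmissibleOn t₁ x₀ y₀ x₁ y₁ q →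
      (1 / 2 : ℝ) * ∫ t in (0 : ℝ)..t₁, p.x t ^ 2 ≤ (1 / 2 : ℝ) * ∫ t in (0 : ℝ)..t₁, q.x t ^ 2

/-- The path resting at the origin with zero control. -/
def rest : Path := ⟨fun _ => 0, fun _ => 0, fun _ => 0⟩

/-- Time reversal `(x(t₁ - t), -y(t₁ - t), u(t₁ - t))`. -/
def reverse (t₁ : ℝ) (p : Path) : Path :=
  ⟨fun t => p.x (t₁ - t), fun t => -p.y (t₁ - t), fun t => p.u (t₁ - t)⟩

/-- The control `u`, considered on `(a, T)`, chatters as `t → T - 0`: near `T` it takes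
(almost everywhere) alternately the values `1` and `-1` on the successive intervals between
infinitely many switching times that increase strictly to `T`. -/
def ChattersLeft (u : ℝ → ℝ) (a T : ℝ) : Prop :=
  ∃ (s : ℕ → ℝ) (σ : ℝ), (σ = 1 ∨ σ = -1) ∧ StrictMono s ∧ (∀ k, s k ∈ Ioo a T) ∧
    Tendsto s atTop (𝓝 T) ∧
    ∀ k, ∀ᵐ t ∂(volume.restrict (Ioo (s k) (s (k + 1)))), u t = σ * (-1) ^ k

/-- The control `u`, considered on `(T, b)`, chatters as `t → T + 0`. -/
def ChattersRight (u : ℝ → ℝ) (T b : ℝ) : Prop :=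
  ∃ (s : ℕ → ℝ) (σ : ℝ), (σ = 1 ∨ σ = -1) ∧ StrictAnti s ∧ (∀ k, s k ∈ Ioo T b) ∧
    Tendsto s atTop (𝓝 T) ∧
    ∀ k, ∀ᵐ t ∂(volume.restrict (Ioo (s (k + 1)) (s k))), u t = σ * (-1) ^ k

end Fuller

namespace Fuller

/-! The dynamics are linear and the cost is a convex quadratic, so the maximum principle is
sufficient for optimality. Integrating the adjoint equations against the difference of a competitor
and an extremal shows that the first variation of the cost is nonnegative as soon as the terminal
term `P δx + Q δy` vanishes. The exact second-order term `∫ (q.x - p.x) ^ 2` then gives optimality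
and uniqueness together (`integral_sq_add_le`, `same_of_integral_sq_le`).

It remains to produce extremals. One self-similar spiral, whose arcs shrink by a fixed ratio `r`,
reaches the origin in finite time with vanishing adjoint variables (`exists_spiral`). Its images
under sign change, scaling and time shift start at every nonzero point (`exists_isExtremal`).

For the finite horizon, one such extremal is added to the time reversal of another. If the arrival
times fit into `[0, t₁]`, then at every moment one of the two is at rest together with its adjoint
variables. The sum is therefore again an extremal (`add_reverse`), with the required end points, and
the sufficiency argument applies to it. -/

/-- A (globally defined) path with adjoint variables `P`, `Q` that satisfies the Pontryagin maximum
principle `Ṗ = x`, `Q̇ = -P`, `u Q = max_{|v| ≤ 1} v Q` on the set `S` of times. -/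
structure IsExtremal (S : Set ℝ) (p : Path) (P Q : ℝ → ℝ) : Prop where
  measurable_u : Measurable p.u
  abs_u_le : ∀ t, |p.u t| ≤ 1
  hasDerivAt_x : ∀ t, HasDerivAt p.x (p.y t) t
  y_sub : ∀ s t, p.y t - p.y s = ∫ τ in s..t, p.u τ
  hasDerivAt_P : ∀ t, HasDerivAt P (p.x t) t
  hasDerivAt_Q : ∀ t, HasDerivAt Q (-P t) t
  u_mul_Q : ∀ t ∈ S, p.u t * Q t = |Q t|

theorem intervalIntegrable_of_abs_le_one {u : ℝ → ℝ} (hu : Measurable u) (h : ∀ t, |u t| ≤ 1)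
    (a b : ℝ) : IntervalIntegrable u volume a b :=
  (intervalIntegrable_const (c := (1 : ℝ))).mono_fun hu.aestronglyMeasurable
    (Eventually.of_forall fun t => by simpa using h t)

/-! ### Sufficiency of the maximum principle -/

namespace IsExtremal

variable {S : Set ℝ} {p q : Path} {P Q : ℝ → ℝ} {L : ℝ}

theorem mono {S' : Set ℝ} (hp : IsExtremal S p P Q) (h : S' ⊆ S) : IsExtremal S' p P Q :=
  { hp with u_mul_Q := fun t ht => hp.u_mul_Q t (h ht) }

theorem intervalIntegrable_u (hp : IsExtremal S p P Q) (a b : ℝ) :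
    IntervalIntegrable p.u volume a b :=
  intervalIntegrable_of_abs_le_one hp.measurable_u hp.abs_u_le a b

theorem continuous_y (hp : IsExtremal S p P Q) : Continuous p.y := by
  have h : p.y = fun t => p.y 0 + ∫ τ in (0 : ℝ)..t, p.u τ := by
    ext t; rw [← hp.y_sub]; ring
  rw [h]
  exact continuous_const.add (intervalIntegral.continuous_primitive hp.intervalIntegrable_u 0)

theorem continuous_x (hp : IsExtremal S p P Q) : Continuous p.x :=
  continuous_iff_continuousAt.2 fun t => (hp.hasDerivAt_x t).continuousAt

theorem continuous_P (hp : IsExtremal S p P Q) : Continuous P :=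
  continuous_iff_continuousAt.2 fun t => (hp.hasDerivAt_P t).continuousAt

theorem continuous_Q (hp : IsExtremal S p P Q) : Continuous Q :=
  continuous_iff_continuousAt.2 fun t => (hp.hasDerivAt_Q t).continuousAt

theorem x_sub (hp : IsExtremal S p P Q) (s t : ℝ) : p.x t - p.x s = ∫ τ in s..t, p.y τ :=
  (intervalIntegral.integral_eq_sub_of_hasDerivAt (fun τ _ => hp.hasDerivAt_x τ)
    (hp.continuous_y.intervalIntegrable _ _)).symm

theorem isTrajectory (hp : IsExtremal S p P Q) (S' : Set ℝ) :
    IsTrajectory S' (p.x 0) (p.y 0) p where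
  aestronglyMeasurable := hp.measurable_u.aestronglyMeasurable
  abs_le_one := Eventually.of_forall hp.abs_u_le
  x_eq t _ := by rw [← hp.x_sub]; ring
  y_eq t _ := by rw [← hp.y_sub]; ring

/-- The difference between an admissible path and an extremal. -/
theorem exists_variation (hp : IsExtremal S p P Q)
    (hq : IsTrajectory (Icc 0 L) (p.x 0) (p.y 0) q) :
    ∃ v G H : ℝ → ℝ, Integrable v volume ∧ (∀ t, G t = ∫ s in (0 : ℝ)..t, v s) ∧
      (∀ t, HasDerivAt H (G t) t) ∧ G 0 = 0 ∧ H 0 = 0 ∧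
      ∀ t ∈ Icc 0 L, v t = q.u t - p.u t ∧ q.y t = p.y t + G t ∧ q.x t = p.x t + H t := by
  have hqu : IntegrableOn q.u (Icc 0 L) := by
    refine Integrable.of_bound hq.aestronglyMeasurable 1 ?_
    filter_upwards [hq.abs_le_one] with t ht using by simpa using ht
  have hpu : IntegrableOn p.u (Icc 0 L) :=
    Measure.integrableOn_of_bounded (M := 1) (by simp) hp.measurable_u.aestronglyMeasurable
      (Eventually.of_forall fun t => by simpa using hp.abs_u_le t)
  -- Extension by zero makes the primitives `G` and `H` globally defined, although `q` is controlled
  -- only on `[0, L]`.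
  set v : ℝ → ℝ := indicator (Icc 0 L) (fun t => q.u t - p.u t) with hv
  have hvi : Integrable v := (hqu.sub hpu).integrable_indicator measurableSet_Icc
  set G : ℝ → ℝ := fun t => ∫ s in (0 : ℝ)..t, v s with hG
  have hGc : Continuous G :=
    intervalIntegral.continuous_primitive (fun a b => hvi.intervalIntegrable) 0
  have hsub : ∀ t ∈ Icc 0 L, uIcc 0 t ⊆ Icc 0 L := fun t ht => by
    rw [uIcc_of_le ht.1]; exact Icc_subset_Icc_right ht.2
  have hy : ∀ t ∈ Icc 0 L, q.y t = p.y t + G t := by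
    intro t ht
    have h1 : G t = ∫ s in (0 : ℝ)..t, (q.u s - p.u s) :=
      intervalIntegral.integral_congr fun s hs => by simp [v, hsub t ht hs]
    have h2 : IntervalIntegrable q.u volume 0 t := (hqu.mono_set (hsub t ht)).intervalIntegrable
    rw [h1, intervalIntegral.integral_sub h2 (hp.intervalIntegrable_u 0 t), hq.y_eq t ht,
      ← hp.y_sub]
    ring
  refine ⟨v, G, fun t => ∫ s in (0 : ℝ)..t, G s, hvi, fun t => rfl, fun t =>
    hGc.integral_hasStrictDerivAt 0 t |>.hasDerivAt, by simp [G], by simp, fun t ht =>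
    ⟨by simp [v, ht], hy t ht, ?_⟩⟩
  have h1 : ∫ s in (0 : ℝ)..t, q.y s = ∫ s in (0 : ℝ)..t, (p.y s + G s) :=
    intervalIntegral.integral_congr fun s hs => hy s (hsub t ht hs)
  rw [hq.x_eq t ht, h1, intervalIntegral.integral_add (hp.continuous_y.intervalIntegrable _ _)
    (hGc.intervalIntegrable _ _), ← hp.x_sub]
  ring

theorem continuousOn_x_of_isTrajectory (hp : IsExtremal S p P Q)
    (hq : IsTrajectory (Icc 0 L) (p.x 0) (p.y 0) q) : ContinuousOn q.x (Icc 0 L) := by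
  obtain ⟨v, G, H, -, -, hH, -, -, h⟩ := hp.exists_variation hq
  have : Continuous H := continuous_iff_continuousAt.2 fun t => (hH t).continuousAt
  exact (hp.continuous_x.add this).continuousOn.congr fun t ht => (h t ht).2.2

/-- If the positions of an admissible path and an extremal coincide, so do the paths. -/
theorem same_of_x_eq (hp : IsExtremal S p P Q) (hL : 0 < L)
    (hq : IsTrajectory (Icc 0 L) (p.x 0) (p.y 0) q) (hx : ∀ t ∈ Icc 0 L, q.x t = p.x t) :
    Same (Icc 0 L) q p := by
  obtain ⟨v, G, H, hv, hG, hH, -, -, h⟩ := hp.exists_variation hq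
  have hH0 : ∀ t ∈ Icc 0 L, H t = 0 := fun t ht => by
    have := (h t ht).2.2; rw [hx t ht] at this; linarith
  have hGc : Continuous G := by
    rw [funext hG]
    exact intervalIntegral.continuous_primitive (fun a b => hv.intervalIntegrable) 0
  have hG0 : ∀ t ∈ Ioo 0 L, G t = 0 := fun t ht => by
    have : H =ᶠ[𝓝 t] fun _ => 0 := by
      filter_upwards [Icc_mem_nhds ht.1 ht.2] with s hs using hH0 s hs
    exact (hH t).unique ((hasDerivAt_const t (0 : ℝ)).congr_of_eventuallyEq this)
  have hG1 : ∀ t ∈ Icc 0 L, G t = 0 := fun t ht => by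
    have : EqOn G (fun _ => 0) (closure (Ioo 0 L)) :=
      EqOn.closure hG0 hGc continuous_const
    rw [closure_Ioo hL.ne] at this
    exact this ht
  refine ⟨fun t ht => ⟨hx t ht, by rw [(h t ht).2.1, hG1 t ht, add_zero]⟩, ?_⟩
  rw [Measure.restrict_congr_set Ioo_ae_eq_Icc.symm, ae_restrict_iff' measurableSet_Ioo]
  -- Lebesgue differentiation: `v` is almost everywhere the derivative of `G`, which vanishes.
  filter_upwards [LocallyIntegrable.ae_hasDerivAt_integral hv.locallyIntegrable] with t ht htm
  have h1 : HasDerivAt G (v t) t := by rw [funext hG]; exact ht 0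
  have : G =ᶠ[𝓝 t] fun _ => 0 := by
    filter_upwards [Ioo_mem_nhds htm.1 htm.2] with s hs using hG0 s hs
  have h2 := h1.unique ((hasDerivAt_const t (0 : ℝ)).congr_of_eventuallyEq this)
  have h3 := (h t (Ioo_subset_Icc_self htm)).1
  linarith

/-- First variation of the cost at an extremal. -/
theorem integral_x_mul_sub_nonneg (hL : 0 ≤ L) (hp : IsExtremal (Icc 0 L) p P Q)
    (hq : IsTrajectory (Icc 0 L) (p.x 0) (p.y 0) q)
    (hbd : P L * (q.x L - p.x L) + Q L * (q.y L - p.y L) = 0) :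
    0 ≤ ∫ t in (0 : ℝ)..L, p.x t * (q.x t - p.x t) := by
  obtain ⟨v, G, H, hv, hG, hH, hG00, hH00, h⟩ := hp.exists_variation hq
  have hGc : Continuous G := by
    rw [funext hG]
    exact intervalIntegral.continuous_primitive (fun a b => hv.intervalIntegrable) 0
  have hHc : Continuous H := continuous_iff_continuousAt.2 fun t => (hH t).continuousAt
  -- `(P H)' = x H + P G` and `(Q G)' = -P G + Q v`. In the sum the terms `P G` cancel, which leaves
  -- `∫ x H = -∫ Q v` by the terminal condition. Since `v` is merely integrable, the second identity
  -- needs integration by parts for absolutely continuous functions.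
  have hPH : ∫ t in (0 : ℝ)..L, (p.x t * H t + P t * G t) = P L * H L := by
    rw [intervalIntegral.integral_eq_sub_of_hasDerivAt
      (fun t _ => (hp.hasDerivAt_P t).fun_mul (hH t))]
    · simp [hH00]
    · exact ((hp.continuous_x.mul hHc).add (hp.continuous_P.mul hGc)).intervalIntegrable _ _
  have hQac : AbsolutelyContinuousOnInterval Q 0 L := by
    apply ContDiffOn.absolutelyContinuousOnInterval
    have : ContDiff ℝ 1 Q := by
      rw [contDiff_one_iff_deriv]
      refine ⟨fun t => (hp.hasDerivAt_Q t).differentiableAt, ?_⟩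
      rw [funext fun t => (hp.hasDerivAt_Q t).deriv]
      exact hp.continuous_P.neg
    exact this.contDiffOn
  have hGac : AbsolutelyContinuousOnInterval G 0 L := by
    rw [funext hG]
    exact IntervalIntegrable.absolutelyContinuousOnInterval_intervalIntegral
      hv.intervalIntegrable left_mem_uIcc
  have hQv : IntervalIntegrable (fun t => Q t * v t) volume 0 L :=
    hv.intervalIntegrable.continuousOn_mul hp.continuous_Q.continuousOn
  have hQG : ∫ t in (0 : ℝ)..L, (-(P t * G t) + Q t * v t) = Q L * G L := by
    have := hQac.integral_deriv_mul_eq_sub hGac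
    rw [hG00, mul_zero, sub_zero] at this
    rw [← this]
    apply intervalIntegral.integral_congr_ae
    filter_upwards [LocallyIntegrable.ae_hasDerivAt_integral hv.locallyIntegrable] with t ht _
    have h1 : HasDerivAt G (v t) t := by rw [funext hG]; exact ht 0
    rw [h1.deriv, (hp.hasDerivAt_Q t).deriv]
    ring
  have hbd' : P L * H L + Q L * G L = 0 := by
    have := h L ⟨hL, le_rfl⟩
    rw [← hbd, this.2.1, this.2.2]
    ring
  have hsum : (∫ t in (0 : ℝ)..L, p.x t * H t) + ∫ t in (0 : ℝ)..L, Q t * v t = 0 := by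
    rw [← intervalIntegral.integral_add]
    · refine Eq.trans ?_ hbd'
      rw [← hPH, ← hQG, ← intervalIntegral.integral_add]
      · exact intervalIntegral.integral_congr fun t _ => by ring
      · exact ((hp.continuous_x.mul hHc).add (hp.continuous_P.mul hGc)).intervalIntegrable _ _
      · exact ((hp.continuous_P.mul hGc).neg.intervalIntegrable _ _).add hQv
    · exact (hp.continuous_x.mul hHc).intervalIntegrable _ _
    · exact hQv
  -- The maximum condition enters here: `Q v = Q q.u - |Q| ≤ 0`.
  have hle : ∫ t in (0 : ℝ)..L, Q t * v t ≤ 0 := by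
    have := intervalIntegral.integral_mono_ae_restrict hL hQv
      (intervalIntegrable_const (c := (0 : ℝ))) ?_
    · simpa using this
    · filter_upwards [hq.abs_le_one, ae_restrict_mem measurableSet_Icc] with t ht htm
      rw [(h t htm).1, mul_sub, mul_comm _ (p.u t), hp.u_mul_Q t htm]
      have : Q t * q.u t ≤ |Q t| := by
        calc Q t * q.u t ≤ |Q t * q.u t| := le_abs_self _
          _ = |Q t| * |q.u t| := abs_mul _ _
          _ ≤ |Q t| * 1 := by gcongr
          _ = |Q t| := mul_one _
      linarith
  have : ∫ t in (0 : ℝ)..L, p.x t * (q.x t - p.x t) = ∫ t in (0 : ℝ)..L, p.x t * H t := by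
    refine intervalIntegral.integral_congr fun t ht => ?_
    rw [uIcc_of_le hL] at ht
    simp only [(h t ht).2.2]
    ring
  linarith

/-- The cost of an admissible path exceeds that of an extremal at least by the squared distance. -/
theorem integral_sq_add_le (hL : 0 ≤ L) (hp : IsExtremal (Icc 0 L) p P Q)
    (hq : IsTrajectory (Icc 0 L) (p.x 0) (p.y 0) q)
    (hbd : P L * (q.x L - p.x L) + Q L * (q.y L - p.y L) = 0) :
    (∫ t in (0 : ℝ)..L, p.x t ^ 2) + ∫ t in (0 : ℝ)..L, (q.x t - p.x t) ^ 2 ≤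
      ∫ t in (0 : ℝ)..L, q.x t ^ 2 := by
  have h := hp.integral_x_mul_sub_nonneg hL hq hbd
  have hqc : ContinuousOn q.x (uIcc 0 L) := by
    rw [uIcc_of_le hL]; exact hp.continuousOn_x_of_isTrajectory hq
  have hpc : ContinuousOn p.x (uIcc 0 L) := hp.continuous_x.continuousOn
  have : ∫ t in (0 : ℝ)..L, q.x t ^ 2 = (∫ t in (0 : ℝ)..L, p.x t ^ 2) +
      (∫ t in (0 : ℝ)..L, (q.x t - p.x t) ^ 2) +
      2 * ∫ t in (0 : ℝ)..L, p.x t * (q.x t - p.x t) := by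
    rw [← intervalIntegral.integral_const_mul, ← intervalIntegral.integral_add,
      ← intervalIntegral.integral_add]
    · exact intervalIntegral.integral_congr fun t _ => by ring
    all_goals exact ContinuousOn.intervalIntegrable (by fun_prop)
  linarith

/-- A path whose cost does not exceed that of an extremal coincides with it. -/
theorem same_of_integral_sq_le (hL : 0 < L) (hp : IsExtremal (Icc 0 L) p P Q)
    (hq : IsTrajectory (Icc 0 L) (p.x 0) (p.y 0) q)
    (hbd : P L * (q.x L - p.x L) + Q L * (q.y L - p.y L) = 0)
    (hle : ∫ t in (0 : ℝ)..L, q.x t ^ 2 ≤ ∫ t in (0 : ℝ)..L, p.x t ^ 2) :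
    Same (Icc 0 L) q p := by
  have h := hp.integral_sq_add_le hL.le hq hbd
  have hqc : ContinuousOn q.x (Icc 0 L) := hp.continuousOn_x_of_isTrajectory hq
  have hpc : ContinuousOn p.x (Icc 0 L) := hp.continuous_x.continuousOn
  have hc : ContinuousOn (fun t => (q.x t - p.x t) ^ 2) (Icc 0 L) := (hqc.sub hpc).pow 2
  have h0 : ∫ t in (0 : ℝ)..L, (q.x t - p.x t) ^ 2 = 0 :=
    le_antisymm (by linarith)
      (intervalIntegral.integral_nonneg hL.le fun t _ => sq_nonneg _)
  refine hp.same_of_x_eq hL hq ?_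
  rw [intervalIntegral.integral_of_le hL.le, ← integral_Icc_eq_integral_Ioc,
    integral_eq_zero_iff_of_nonneg (fun t => sq_nonneg _)
      (hc.integrableOn_compact isCompact_Icc)] at h0
  have := Measure.eqOn_Icc_of_ae_eq volume hL.ne h0 hc continuousOn_const
  intro t ht
  have h2 := this ht
  simp only [Pi.zero_apply] at h2
  have := pow_eq_zero_iff (two_ne_zero) |>.1 h2
  linarith

end IsExtremal
-- Construction of the self-similar spiral
/-- The constants of the self-similar Fuller spiral: `r` is the contraction ratio, `x = C y²` the
switching curve for `y < 0`, and `κ` the slope of the adjoint variable at a switching. -/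
theorem exists_spiral_constants : ∃ r C κ : ℝ, 0 < r ∧ r ≤ 1 / 3 ∧ 0 < C ∧ C < 1 / 2 ∧
    C - (1 + r) + (1 + r) ^ 2 / 2 = -(r ^ 2 * C) ∧
    κ * (1 + r) - C * (1 + r) ^ 2 / 2 + (1 + r) ^ 3 / 6 - (1 + r) ^ 4 / 24 = 0 ∧
    -κ + C * (1 + r) - (1 + r) ^ 2 / 2 + (1 + r) ^ 3 / 6 = r ^ 3 * κ ∧
    ∀ t ∈ Icc 0 (1 + r), 0 ≤ κ * t - C * t ^ 2 / 2 + t ^ 3 / 6 - t ^ 4 / 24 := by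
  -- The similarity relation for `x` gives `C = c r`, and `Q = 0` at the end of the arc gives `κ =
  -- (1 + r) * k r`. The similarity relation for `P`, divided by `1 + r`, is then one equation for
  -- `r`, solved by a sign change on `[1/5, 1/3]`.
  let c : ℝ → ℝ := fun r => (1 - r ^ 2) / (2 * (1 + r ^ 2))
  let k : ℝ → ℝ := fun r => c r / 2 - (1 + r) / 6 + (1 + r) ^ 2 / 24
  have hc : Continuous c := by
    refine Continuous.div (by fun_prop) (by fun_prop) fun r => ?_
    positivity
  obtain ⟨r, ⟨hr1, hr2⟩, hr⟩ : (0 : ℝ) ∈ (fun r =>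
      k r * (1 + r ^ 3) - (c r - (1 + r) / 2 + (1 + r) ^ 2 / 6)) '' Icc (1 / 5) (1 / 3) := by
    refine intermediate_value_Icc (by norm_num) ?_ ?_
    · exact Continuous.continuousOn (by fun_prop)
    · constructor <;> norm_num [k, c]
  have hC : c r * (2 * (1 + r ^ 2)) = 1 - r ^ 2 := by
    simp only [c]; field_simp
  have hC2 : 2 / 5 ≤ c r := by
    simp only [c]; rw [le_div_iff₀ (by positivity)]; nlinarith
  have hC3 : c r < 1 / 2 := by
    simp only [c]; rw [div_lt_iff₀ (by positivity)]; nlinarith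
  have hk : 0 ≤ k r := by simp only [k]; nlinarith
  have hkd : k r = c r / 2 - (1 + r) / 6 + (1 + r) ^ 2 / 24 := rfl
  simp only at hr
  generalize c r = C at *
  generalize k r = K at *
  have hP : -((1 + r) * K) + C * (1 + r) - (1 + r) ^ 2 / 2 + (1 + r) ^ 3 / 6
      = r ^ 3 * ((1 + r) * K) := by linear_combination (-(1 + r)) * hr
  refine ⟨r, C, (1 + r) * K, by linarith, hr2, by linarith, hC3, by linear_combination hC / 2,
    by rw [hkd]; ring, hP, fun t ht => ?_⟩
  obtain ⟨ht0, ht1⟩ := ht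
  have hfac : (1 + r) * K * t - C * t ^ 2 / 2 + t ^ 3 / 6 - t ^ 4 / 24 =
      t * ((1 + r) - t) * (t ^ 2 + (r - 3) * t + 24 * K) / 24 := by
    have : C = 2 * (K + (1 + r) / 6 - (1 + r) ^ 2 / 24) := by linarith
    rw [this]; ring
  have hend : 0 ≤ 2 * (1 + r) ^ 2 - 4 * (1 + r) + 24 * K := by
    have : (2 * (1 + r) ^ 2 - 4 * (1 + r) + 24 * K) = 24 * (r ^ 3 * K) := by
      have : C = 2 * (K + (1 + r) / 6 - (1 + r) ^ 2 / 24) := by linarith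
      subst this
      linear_combination (-24) * hr
    rw [this]; positivity
  -- This product is the quadratic factor minus its value at `t = 1 + r`. It is nonnegative because
  -- `r ≤ 1 / 3`, and the end value is `24 r³ K ≥ 0`.
  have hdec : 0 ≤ (1 + r - t) * (4 - 2 * (1 + r) - t) :=
    mul_nonneg (by linarith) (by linarith)
  rw [hfac]
  have : 0 ≤ t ^ 2 + (r - 3) * t + 24 * K := by nlinarith
  have h2 : 0 ≤ 1 + r - t := by linarith
  positivity

theorem eqOn_Icc_of_hasDerivAt {f f' g g' : ℝ → ℝ} {s t : ℝ}
    (hf : ∀ τ, HasDerivAt f (f' τ) τ) (hg : ∀ τ, HasDerivAt g (g' τ) τ)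
    (h : EqOn f' g' (Icc s t)) (hs : f s = g s) : EqOn f g (Icc s t) := by
  refine eq_of_has_deriv_right_eq (f' := f') (fun x _ => (hf x).hasDerivWithinAt)
    (fun x hx => ?_) (fun x _ => (hf x).continuousAt.continuousWithinAt)
    (fun x _ => (hg x).continuousAt.continuousWithinAt) hs
  rw [h ⟨hx.1, hx.2.le⟩]
  exact (hg x).hasDerivWithinAt

/-- Explicit solution of the extremal system where the control is constant. -/
theorem IsExtremal.eqOn_of_u_eq {S : Set ℝ} {p : Path} {P Q : ℝ → ℝ} (hp : IsExtremal S p P Q)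
    {s t σ : ℝ} (hu : ∀ τ ∈ Ico s t, p.u τ = σ) :
    EqOn p.y (fun τ => p.y s + σ * (τ - s)) (Icc s t) ∧
    EqOn p.x (fun τ => p.x s + p.y s * (τ - s) + σ * (τ - s) ^ 2 / 2) (Icc s t) ∧
    EqOn P (fun τ => P s + p.x s * (τ - s) + p.y s * (τ - s) ^ 2 / 2 + σ * (τ - s) ^ 3 / 6)
      (Icc s t) ∧
    EqOn Q (fun τ => Q s - P s * (τ - s) - p.x s * (τ - s) ^ 2 / 2 - p.y s * (τ - s) ^ 3 / 6
      - σ * (τ - s) ^ 4 / 24) (Icc s t) := by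
  have hd : ∀ (c : ℝ) (n : ℕ) (τ : ℝ),
      HasDerivAt (fun τ : ℝ => c * (τ - s) ^ (n + 1)) (c * ((n + 1 : ℕ) * (τ - s) ^ n)) τ :=
    fun c n τ => by
      simpa using (((hasDerivAt_id τ).sub_const s).fun_pow (n + 1)).const_mul c
  have hy : EqOn p.y (fun τ => p.y s + σ * (τ - s)) (Icc s t) := by
    intro τ hτ
    have h1 : ∫ z in s..τ, p.u z = ∫ _ in s..τ, σ := by
      rw [intervalIntegral.integral_of_le hτ.1, intervalIntegral.integral_of_le hτ.1,
        ← integral_Ico_eq_integral_Ioc, ← integral_Ico_eq_integral_Ioc]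
      exact setIntegral_congr_fun measurableSet_Ico fun z hz => hu z ⟨hz.1, hz.2.trans_le hτ.2⟩
    have h2 := hp.y_sub s τ
    rw [h1, intervalIntegral.integral_const, smul_eq_mul] at h2
    simp only
    linarith
  have hx : EqOn p.x (fun τ => p.x s + p.y s * (τ - s) + σ * (τ - s) ^ 2 / 2) (Icc s t) := by
    refine eqOn_Icc_of_hasDerivAt hp.hasDerivAt_x (fun τ => ?_) hy (by simp)
    refine HasDerivAt.congr_deriv (f' := _) (HasDerivAt.congr_of_eventuallyEq
      (((hd (p.y s) 0 τ).const_add (p.x s)).add (hd (σ / 2) 1 τ))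
      (Eventually.of_forall fun z => ?_)) ?_
    · simp only [Pi.add_apply]; ring
    · push_cast; ring
  have hP : EqOn P (fun τ => P s + p.x s * (τ - s) + p.y s * (τ - s) ^ 2 / 2
      + σ * (τ - s) ^ 3 / 6) (Icc s t) := by
    refine eqOn_Icc_of_hasDerivAt hp.hasDerivAt_P (fun τ => ?_) hx (by simp)
    refine HasDerivAt.congr_deriv (f' := _) (HasDerivAt.congr_of_eventuallyEq
      ((((hd (p.x s) 0 τ).const_add (P s)).add (hd (p.y s / 2) 1 τ)).add (hd (σ / 6) 2 τ))
      (Eventually.of_forall fun z => ?_)) ?_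
    · simp only [Pi.add_apply]; ring
    · push_cast; ring
  refine ⟨hy, hx, hP, ?_⟩
  refine eqOn_Icc_of_hasDerivAt hp.hasDerivAt_Q (fun τ => ?_) (fun τ hτ => congrArg Neg.neg (hP hτ))
    (by simp)
  refine HasDerivAt.congr_deriv (f' := _) (HasDerivAt.congr_of_eventuallyEq
    (((((hd (-P s) 0 τ).const_add (Q s)).add (hd (-(p.x s) / 2) 1 τ)).add
      (hd (-(p.y s) / 6) 2 τ)).add (hd (-σ / 24) 3 τ))
    (Eventually.of_forall fun z => ?_)) ?_
  · simp only [Pi.add_apply]; ring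
  · push_cast; ring

/-- Over `∅` the maximum condition is void, so this only integrates the linear system for a given
control. The condition is verified separately once `Q` is known. -/
theorem exists_isExtremal_empty {u : ℝ → ℝ} (hu : Measurable u) (h : ∀ t, |u t| ≤ 1)
    (a b c d : ℝ) : ∃ (p : Path) (P Q : ℝ → ℝ), IsExtremal ∅ p P Q ∧ p.u = u ∧
      p.x 0 = a ∧ p.y 0 = b ∧ P 0 = c ∧ Q 0 = d := by
  have hui := intervalIntegrable_of_abs_le_one hu h
  have key : ∀ (f : ℝ → ℝ) (e : ℝ), Continuous f →
      ∃ F : ℝ → ℝ, (∀ t, HasDerivAt F (f t) t) ∧ F 0 = e := fun f e hf =>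
    ⟨fun t => e + ∫ s in (0 : ℝ)..t, f s,
      fun t => (hf.integral_hasStrictDerivAt 0 t).hasDerivAt.const_add e, by simp⟩
  have cont : ∀ {F f : ℝ → ℝ}, (∀ t, HasDerivAt F (f t) t) → Continuous F := fun hF =>
    continuous_iff_continuousAt.2 fun t => (hF t).continuousAt
  set y : ℝ → ℝ := fun t => b + ∫ s in (0 : ℝ)..t, u s with hy
  have hyc : Continuous y := continuous_const.add (intervalIntegral.continuous_primitive hui 0)
  obtain ⟨x, hx, hx0⟩ := key y a hyc
  obtain ⟨P, hP, hP0⟩ := key x c (cont hx)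
  obtain ⟨Q, hQ, hQ0⟩ := key (fun t => -P t) d (cont hP).neg
  refine ⟨⟨x, y, u⟩, P, Q, ⟨hu, h, hx, fun s t => ?_, hP, hQ, by simp⟩, rfl, hx0,
    by simp [y], hP0, hQ0⟩
  simp only [y]
  rw [← intervalIntegral.integral_interval_sub_left (hui 0 t) (hui 0 s)]
  ring

/-- A measurable control that alternates between `1` and `-1` on intervals whose lengths form a
geometric progression, and vanishes after the accumulation point of the switching times. -/
theorem exists_alternating_control {r T : ℝ} (hr0 : 0 < r) (hr1 : r < 1) (hT : 0 < T) :
    ∃ u : ℝ → ℝ, Measurable u ∧ (∀ t, |u t| ≤ 1) ∧ (∀ t, T ≤ t → u t = 0) ∧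
      ∀ k : ℕ, ∀ t ∈ Ico (T * (1 - r ^ k)) (T * (1 - r ^ (k + 1))), u t = (-1) ^ k := by
  -- On the `k`-th arc `r ^ (k + 1) < 1 - t / T ≤ r ^ k`, so the floor of the logarithm to base `r <
  -- 1` is `k`.
  refine ⟨fun t => if t < T then (-1) ^ ⌊Real.logb r (1 - t / T)⌋₊ else 0, ?_, ?_, ?_, ?_⟩
  · refine Measurable.ite measurableSet_Iio ?_ measurable_const
    have h1 : Measurable fun t : ℝ => ⌊Real.logb r (1 - t / T)⌋₊ := by
      simp only [Real.logb]
      fun_prop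
    exact (measurable_from_nat (f := fun n : ℕ => (-1 : ℝ) ^ n)).comp h1
  · intro t
    dsimp only
    split_ifs <;> simp
  · intro t ht
    simp [not_lt.2 ht]
  · intro k t ⟨h1, h2⟩
    have e1 : 1 - t / T ≤ r ^ k := by
      have : 1 - r ^ k ≤ t / T := by rw [le_div_iff₀ hT]; linarith
      linarith
    have e2 : r ^ (k + 1) < 1 - t / T := by
      have : t / T < 1 - r ^ (k + 1) := by rw [div_lt_iff₀ hT]; linarith
      linarith
    have e3 : 0 < 1 - t / T := lt_trans (by positivity) e2
    have e4 : t < T := by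
      have : t / T < 1 := by linarith
      rwa [div_lt_one hT] at this
    have e5 : (k : ℝ) ≤ Real.logb r (1 - t / T) := by
      rw [Real.le_logb_iff_rpow_le_of_base_lt_one hr0 hr1 e3]
      exact_mod_cast e1
    have e6 : Real.logb r (1 - t / T) < k + 1 := by
      rw [Real.logb_lt_iff_lt_rpow_of_base_lt_one hr0 hr1 e3]
      exact_mod_cast e2
    have : ⌊Real.logb r (1 - t / T)⌋₊ = k :=
      (Nat.floor_eq_iff (le_trans (by positivity) e5)).2 ⟨e5, e6⟩
    simp [e4, this]

/-- The path and its adjoint variables are at rest from the time `T` on. -/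
def RestsFrom (T : ℝ) (p : Path) (P Q : ℝ → ℝ) : Prop :=
  ∀ t, T ≤ t → p.x t = 0 ∧ p.y t = 0 ∧ p.u t = 0 ∧ P t = 0 ∧ Q t = 0

/-- The self-similar Fuller spiral, from its switching point `(C, -1)` on. -/
theorem exists_spiral : ∃ (r C T : ℝ) (s : ℕ → ℝ) (p : Path) (P Q : ℝ → ℝ), 0 < r ∧ r < 1 ∧
    C < 1 / 2 ∧ 0 < C ∧ C - (1 + r) + (1 + r) ^ 2 / 2 = -(r ^ 2 * C) ∧
    IsExtremal (Ici 0) p P Q ∧ RestsFrom T p P Q ∧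
    StrictMono s ∧ s 0 = 0 ∧ s 1 = 1 + r ∧ Tendsto s atTop (𝓝 T) ∧
    (∀ k, ∀ t ∈ Ico (s k) (s (k + 1)), p.u t = (-1) ^ k) ∧
    ∀ t ∈ Icc 0 (1 + r), p.y t = -1 + t ∧ p.x t = C - t + t ^ 2 / 2 := by
  obtain ⟨r, C, κ, hr0, hr3, hC0, hC, hx, hQ, hP, hpos⟩ := exists_spiral_constants
  have hr1 : r < 1 := by linarith
  have h1r : 0 < 1 - r := by linarith
  -- Under `u = 1` the velocity goes from `-1` to `r` in time `1 + r`; `T` is the sum of the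
  -- geometric series of arc lengths `r ^ k * (1 + r)`.
  set T : ℝ := (1 + r) / (1 - r) with hTdef
  have hT : 0 < T := by positivity
  have hTr : T * (1 - r) = 1 + r := by rw [hTdef]; field_simp
  clear_value T
  obtain ⟨u, hum, hu1, huT, huk⟩ := exists_alternating_control hr0 hr1 hT
  obtain ⟨p, P, Q, hp, rfl, hx0, hy0, hP0, hQ0⟩ := exists_isExtremal_empty hum hu1 C (-1) (-κ) 0
  set s : ℕ → ℝ := fun k => T * (1 - r ^ k) with hs
  have hs1 : ∀ k, s (k + 1) - s k = r ^ k * (1 + r) := fun k => by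
    simp only [hs]; rw [← hTr]; ring
  have hlen : ∀ k, 0 < s (k + 1) - s k := fun k => by rw [hs1]; positivity
  have hsm : StrictMono s := strictMono_nat_of_lt_succ fun k => by linarith [hlen k]
  have hs0 : s 0 = 0 := by simp [s]
  have hst : Tendsto s atTop (𝓝 T) := by
    have := ((tendsto_pow_atTop_nhds_zero_of_lt_one hr0.le hr1).const_sub 1).const_mul T
    simpa using this
  replace huk : ∀ k : ℕ, ∀ t ∈ Ico (s k) (s (k + 1)), p.u t = (-1) ^ k := huk
  have hval : ∀ k : ℕ, p.x (s k) = (-1) ^ k * (r ^ k) ^ 2 * C ∧ p.y (s k) = -((-1) ^ k * r ^ k) ∧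
      P (s k) = -((-1) ^ k * (r ^ k) ^ 3 * κ) ∧ Q (s k) = 0 := by
    intro k
    induction k with
    | zero => rw [hs0]; simp [hx0, hy0, hP0, hQ0]
    | succ k ih =>
      obtain ⟨i1, i2, i3, i4⟩ := ih
      obtain ⟨j2, j1, j3, j4⟩ := hp.eqOn_of_u_eq (huk k)
      have hm : s (k + 1) ∈ Icc (s k) (s (k + 1)) := ⟨by linarith [hlen k], le_rfl⟩
      refine ⟨(j1 hm).trans ?_, (j2 hm).trans ?_, (j3 hm).trans ?_, (j4 hm).trans ?_⟩ <;>
        simp only [hs1, i1, i2, i3, i4]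
      · linear_combination (-1) ^ k * (r ^ k) ^ 2 * hx
      · ring
      · linear_combination (-1) ^ k * (r ^ k) ^ 3 * hP
      · linear_combination (-1) ^ k * (r ^ k) ^ 4 * hQ
  have hrk : Tendsto (fun k : ℕ => r ^ k) atTop (𝓝 0) :=
    tendsto_pow_atTop_nhds_zero_of_lt_one hr0.le hr1
  -- The values at the switchings decay geometrically, so continuity forces them to vanish at `T`.
  have hlim : ∀ (f : ℝ → ℝ) (c : ℝ) (n : ℕ), n ≠ 0 → Continuous f →
      (∀ k : ℕ, |f (s k)| = (r ^ k) ^ n * c) → f T = 0 := by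
    intro f c n hn hf h
    have h1 : Tendsto (fun k => f (s k)) atTop (𝓝 0) := by
      rw [tendsto_zero_iff_abs_tendsto_zero]
      have := ((hrk.pow n).mul_const c)
      rw [zero_pow hn, zero_mul] at this
      exact this.congr fun k => (h k).symm
    exact tendsto_nhds_unique ((hf.tendsto T).comp hst) h1
  have hxT : p.x T = 0 := hlim p.x |C| 2 (by norm_num) hp.continuous_x fun k => by
    rw [(hval k).1]; simp [abs_mul, abs_of_pos hr0]
  have hyT : p.y T = 0 := hlim p.y 1 1 (by norm_num) hp.continuous_y fun k => by
    rw [(hval k).2.1]; simp [abs_mul, abs_of_pos hr0]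
  have hPT : P T = 0 := hlim P |κ| 3 (by norm_num) hp.continuous_P fun k => by
    rw [(hval k).2.2.1]; simp [abs_mul, abs_of_pos hr0]
  have hQT : Q T = 0 := hlim Q 0 1 (by norm_num) hp.continuous_Q fun k => by
    rw [(hval k).2.2.2]; simp
  have hrest : RestsFrom T p P Q := by
    intro t ht
    obtain ⟨j2, j1, j3, j4⟩ := hp.eqOn_of_u_eq (s := T) (t := t) (σ := 0) fun τ hτ => huT τ hτ.1
    have hm : t ∈ Icc T t := ⟨ht, le_rfl⟩
    refine ⟨(j1 hm).trans ?_, (j2 hm).trans ?_, huT t ht, (j3 hm).trans ?_, (j4 hm).trans ?_⟩ <;>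
      simp [hxT, hyT, hPT, hQT]
  have hmax : ∀ t ∈ Ici (0 : ℝ), p.u t * Q t = |Q t| := by
    intro t ht0
    rcases le_or_gt T t with ht | ht
    · simp [(hrest t ht).2.2.2.2]
    have hq0 : 0 < 1 - t / T := by
      rw [sub_pos, div_lt_one hT]; exact ht
    have hq1 : 1 - t / T ≤ 1 := by
      have : 0 ≤ t / T := div_nonneg ht0 hT.le
      linarith
    obtain ⟨k, hk1, hk2⟩ := exists_nat_pow_near_of_lt_one hq0 hq1 hr0 hr1
    have htT : T * (1 - t / T) = T - t := by field_simp
    have hmem : t ∈ Ico (s k) (s (k + 1)) := by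
      constructor
      · have := mul_le_mul_of_nonneg_left hk2 hT.le
        simp only [hs]; linarith
      · have := mul_lt_mul_of_pos_left hk1 hT
        simp only [hs]; linarith
    obtain ⟨i1, i2, i3, i4⟩ := hval k
    obtain ⟨-, -, -, j4⟩ := hp.eqOn_of_u_eq (huk k)
    have hrkp : 0 < r ^ k := by positivity
    -- Rescaling the `k`-th arc to `[0, 1 + r]` turns `Q` into `(-1) ^ k * (r ^ k) ^ 4` times the
    -- nonnegative polynomial of the first arc.
    set z : ℝ := (t - s k) / r ^ k with hz
    have hzt : t - s k = r ^ k * z := by rw [hz]; field_simp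
    have hzm : z ∈ Icc 0 (1 + r) := by
      constructor
      · exact div_nonneg (by linarith [hmem.1]) hrkp.le
      · rw [hz, div_le_iff₀ hrkp]
        linarith [hs1 k, hmem.2]
    have hQt : Q t = (-1) ^ k *
        ((r ^ k) ^ 4 * (κ * z - C * z ^ 2 / 2 + z ^ 3 / 6 - z ^ 4 / 24)) := by
      refine (j4 ⟨hmem.1, hmem.2.le⟩).trans ?_
      simp only [i1, i2, i3, i4, hzt]
      ring
    have hnn := mul_nonneg (pow_nonneg hrkp.le 4) (hpos z hzm)
    rw [huk k t hmem, hQt, abs_mul, abs_of_nonneg hnn, ← mul_assoc, ← mul_pow]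
    simp
  have hs11 : s 1 = 1 + r := by simp only [hs]; rw [← hTr]; ring
  refine ⟨r, C, T, s, p, P, Q, hr0, hr1, hC, hC0, hx, { hp with u_mul_Q := hmax }, hrest, hsm, hs0,
    hs11, hst, huk, fun t ht => ?_⟩
  obtain ⟨j2, j1, -, -⟩ := hp.eqOn_of_u_eq (huk 0)
  have hm : t ∈ Icc (s 0) (s (0 + 1)) := by rw [zero_add, hs0, hs11]; exact ht
  refine ⟨(j2 hm).trans ?_, (j1 hm).trans ?_⟩ <;> simp only [hs0, hx0, hy0] <;> ring

/-- The control `u` takes alternately the values `1` and `-1` on intervals between switching times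
in `(0, T)` that increase strictly to `T`. -/
def AlternatesTo (u : ℝ → ℝ) (T : ℝ) : Prop :=
  ∃ (s : ℕ → ℝ) (σ : ℝ), (σ = 1 ∨ σ = -1) ∧ StrictMono s ∧ (∀ k, s k ∈ Ioo 0 T) ∧
    Tendsto s atTop (𝓝 T) ∧ ∀ k, ∀ t ∈ Ico (s k) (s (k + 1)), u t = σ * (-1) ^ k

theorem AlternatesTo.chattersLeft {u v : ℝ → ℝ} {T : ℝ} (h : AlternatesTo u T)
    (huv : ∀ t ∈ Icc 0 T, v t = u t) : ChattersLeft v 0 T := by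
  obtain ⟨s, σ, hσ, hs, hm, hT, hu⟩ := h
  refine ⟨s, σ, hσ, hs, hm, hT, fun k => ?_⟩
  refine (ae_restrict_iff' measurableSet_Ioo).2 (Eventually.of_forall fun t ht => ?_)
  rw [huv t ⟨((hm k).1.trans ht.1).le, (ht.2.trans (hm (k + 1)).2).le⟩]
  exact hu k t (Ioo_subset_Ico_self ht)

theorem AlternatesTo.chattersRight {u v : ℝ → ℝ} {T L : ℝ} (h : AlternatesTo u T)
    (huv : ∀ t ∈ Icc 0 T, v (L - t) = u t) : ChattersRight v (L - T) L := by
  obtain ⟨s, σ, hσ, hs, hm, hT, hu⟩ := h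
  refine ⟨fun k => L - s k, σ, hσ, fun i j hij => sub_lt_sub_left (hs hij) L,
    fun k => ⟨by linarith [(hm k).2], by linarith [(hm k).1]⟩, hT.const_sub L, fun k => ?_⟩
  refine (ae_restrict_iff' measurableSet_Ioo).2 (Eventually.of_forall fun t ht => ?_)
  have h1 : s k < L - t := by linarith [ht.2]
  have h2 : L - t < s (k + 1) := by linarith [ht.1]
  have := huv (L - t) ⟨((hm k).1.trans h1).le, (h2.trans (hm (k + 1)).2).le⟩
  rw [sub_sub_cancel] at this
  rw [this]
  exact hu k _ ⟨h1.le, h2⟩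

/-! ### Symmetries, superposition and minimality of the rest time -/

namespace IsExtremal

variable {p : Path} {P Q : ℝ → ℝ} {T : ℝ}

/-- Extremals are invariant under the symmetries of the Fuller problem. -/
theorem rescale (hp : IsExtremal (Ici 0) p P Q) {σ c d : ℝ} (hσ : σ = 1 ∨ σ = -1) (hc : 0 < c)
    (hd : 0 ≤ d) :
    IsExtremal (Ici 0) ⟨fun t => σ * c ^ 2 * p.x (d + t / c), fun t => σ * c * p.y (d + t / c),
      fun t => σ * p.u (d + t / c)⟩ (fun t => σ * c ^ 3 * P (d + t / c))
      (fun t => σ * c ^ 4 * Q (d + t / c)) := by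
  have hσa : |σ| = 1 := by rcases hσ with rfl | rfl <;> simp
  have hσ2 : σ * σ = 1 := by rcases hσ with rfl | rfl <;> simp
  have haff : ∀ t, HasDerivAt (fun t : ℝ => d + t / c) (1 / c) t := fun t =>
    ((hasDerivAt_id t).div_const c).const_add d
  refine ⟨?_, fun t => ?_, fun t => ?_, fun s t => ?_, fun t => ?_, fun t => ?_, fun t ht => ?_⟩
  · have := hp.measurable_u
    fun_prop
  · simpa [abs_mul, hσa] using hp.abs_u_le _
  · refine (((hp.hasDerivAt_x _).comp t (haff t)).const_mul (σ * c ^ 2)).congr_deriv ?_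
    field_simp
  · simp only
    rw [intervalIntegral.integral_const_mul, intervalIntegral.integral_comp_add_div _ hc.ne',
      ← hp.y_sub, smul_eq_mul]
    ring
  · refine (((hp.hasDerivAt_P _).comp t (haff t)).const_mul (σ * c ^ 3)).congr_deriv ?_
    field_simp
  · refine (((hp.hasDerivAt_Q _).comp t (haff t)).const_mul (σ * c ^ 4)).congr_deriv ?_
    field_simp
  · have h0 : 0 ≤ d + t / c := add_nonneg hd (div_nonneg ht hc.le)
    have := hp.u_mul_Q _ h0
    simp only [abs_mul, hσa, ← this, abs_of_pos (pow_pos hc 4)]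
    linear_combination (c ^ 4 * p.u (d + t / c) * Q (d + t / c)) * hσ2

theorem rescale_restsFrom (h : RestsFrom T p P Q) {σ c d : ℝ} (hc : 0 < c) :
    RestsFrom (c * (T - d)) ⟨fun t => σ * c ^ 2 * p.x (d + t / c),
      fun t => σ * c * p.y (d + t / c), fun t => σ * p.u (d + t / c)⟩
      (fun t => σ * c ^ 3 * P (d + t / c)) (fun t => σ * c ^ 4 * Q (d + t / c)) := by
  intro t ht
  have h1 : T ≤ d + t / c := by
    have : T - d ≤ t / c := by rw [le_div_iff₀ hc]; linarith
    linarith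
  obtain ⟨h2, h3, h4, h5, h6⟩ := h _ h1
  simp [h2, h3, h4, h5, h6]

/-- Superposition of an extremal that comes to rest and a time-reversed one. -/
theorem add_reverse {p' : Path} {P' Q' : ℝ → ℝ} {T' L : ℝ}
    (hp : IsExtremal (Ici 0) p P Q) (hr : RestsFrom T p P Q)
    (hp' : IsExtremal (Ici 0) p' P' Q') (hr' : RestsFrom T' p' P' Q') (hL : T + T' ≤ L) :
    IsExtremal (Icc 0 L) ⟨fun t => p.x t + p'.x (L - t), fun t => p.y t - p'.y (L - t),
      fun t => p.u t + p'.u (L - t)⟩ (fun t => P t - P' (L - t)) (fun t => Q t + Q' (L - t)) := by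
  have haff : ∀ t, HasDerivAt (fun t : ℝ => L - t) (-1) t := fun t =>
    (hasDerivAt_id t).const_sub L
  -- The differential equations superpose by linearity. The control bound and the maximum condition
  -- do not, but at each time one summand vanishes.
  have hcases : ∀ t, RestsFrom T p P Q ∧ T ≤ t ∨ T' ≤ L - t := fun t => by
    rcases le_or_gt T t with h | h
    · exact Or.inl ⟨hr, h⟩
    · right; linarith
  refine ⟨?_, fun t => ?_, fun t => ?_, fun s t => ?_, fun t => ?_, fun t => ?_, fun t ht => ?_⟩
  · have := hp.measurable_u
    have := hp'.measurable_u
    fun_prop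
  · rcases hcases t with ⟨-, h⟩ | h
    · simpa [(hr t h).2.2.1] using hp'.abs_u_le (L - t)
    · simpa [(hr' _ h).2.2.1] using hp.abs_u_le t
  · refine ((hp.hasDerivAt_x t).add ((hp'.hasDerivAt_x _).comp t (haff t))).congr_deriv ?_
    simp only; ring
  · have h1 : IntervalIntegrable (fun τ => p'.u (L - τ)) volume s t :=
      intervalIntegrable_of_abs_le_one (hp'.measurable_u.comp (by fun_prop))
        (fun τ => hp'.abs_u_le _) s t
    simp only
    rw [intervalIntegral.integral_add (hp.intervalIntegrable_u s t) h1,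
      intervalIntegral.integral_comp_sub_left, ← hp.y_sub, ← hp'.y_sub]
    ring
  · refine ((hp.hasDerivAt_P t).sub ((hp'.hasDerivAt_P _).comp t (haff t))).congr_deriv ?_
    simp only; ring
  · refine ((hp.hasDerivAt_Q t).add ((hp'.hasDerivAt_Q _).comp t (haff t))).congr_deriv ?_
    ring
  · rcases hcases t with ⟨-, h⟩ | h
    · simpa [(hr t h).2.2.1, (hr t h).2.2.2.2] using hp'.u_mul_Q (L - t) (by simpa using ht.2)
    · simpa [(hr' _ h).2.2.1, (hr' _ h).2.2.2.2] using hp.u_mul_Q t ht.1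

/-- Between switchings `y` has slope `±1`, and the switchings accumulate at `T`, so no rest can
begin before `T`. -/
theorem restsFrom_isLeast (hp : IsExtremal (Ici 0) p P Q) (hT : 0 ≤ T) (hr : RestsFrom T p P Q)
    (h : T = 0 ∨ AlternatesTo p.u T) : IsLeast (restTimes p) T := by
  refine ⟨⟨hT, fun t ht => ⟨(hr t ht).1, (hr t ht).2.1⟩⟩, fun T' hT' => ?_⟩
  rcases h with rfl | ⟨s, σ, hσ, hs, hm, hlim, hu⟩
  · exact hT'.1
  by_contra! hlt
  obtain ⟨k, hk⟩ := (hlim.eventually (lt_mem_nhds hlt)).exists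
  have hsk := hs (Nat.lt_succ_self k)
  have h1 := (hp.eqOn_of_u_eq (hu k)).1 (right_mem_Icc.2 hsk.le)
  simp only [(hT'.2 _ hk.le).2, (hT'.2 _ (hk.le.trans hsk.le)).2, zero_add] at h1
  have h2 : s (k + 1) - s k ≠ 0 := sub_ne_zero.2 hsk.ne'
  have h3 : σ ≠ 0 := by rcases hσ with rfl | rfl <;> norm_num
  have h4 : (-1 : ℝ) ^ k ≠ 0 := by simp
  exact mul_ne_zero (mul_ne_zero h3 h4) h2 h1.symm

end IsExtremal

/-! ### Extremals from arbitrary initial points -/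

/-- From every point there starts an extremal that reaches the origin in finite time. -/
theorem exists_isExtremal (a b : ℝ) : ∃ (T : ℝ) (p : Path) (P Q : ℝ → ℝ), 0 ≤ T ∧ p.x 0 = a ∧
    p.y 0 = b ∧ IsExtremal (Ici 0) p P Q ∧ RestsFrom T p P Q ∧
    (T = 0 ∨ AlternatesTo p.u T) ∧ ((a, b) ≠ (0, 0) → AlternatesTo p.u T) := by
  by_cases h0 : (a, b) = (0, 0)
  · obtain ⟨rfl, rfl⟩ := Prod.mk.inj h0
    refine ⟨0, rest, fun _ => 0, fun _ => 0, le_rfl, rfl, rfl, ?_, fun t _ => by simp [rest],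
      Or.inl rfl, fun h => absurd rfl h⟩
    constructor <;> simp [rest, hasDerivAt_const]
  obtain ⟨r, C, T, s, p, P, Q, hr0, hr1, hC, hC0, hrC, hp, hrest, hsm, hs0, hs1, hst, hu, hxy⟩ :=
    exists_spiral
  obtain ⟨σ, c, d, hσ, hc, hd0, hd1, ha, hb⟩ : ∃ σ c d : ℝ, (σ = 1 ∨ σ = -1) ∧ 0 < c ∧ 0 ≤ d ∧
      d < 1 + r ∧ σ * c ^ 2 * (C - d + d ^ 2 / 2) = a ∧ σ * c * (-1 + d) = b := by
    -- These are the points on one side of the switching curve, where `u = 1`. The remaining nonzero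
    -- points are their reflections, reached with `σ = -1`.
    have key : ∀ a b : ℝ, (b ≤ 0 ∧ a ≤ C * b ^ 2 ∧ (a, b) ≠ (0, 0)) ∨
        (0 < b ∧ a < -(C * b ^ 2)) → ∃ c d : ℝ, 0 < c ∧ 0 ≤ d ∧ d < 1 + r ∧
          c ^ 2 * (C - d + d ^ 2 / 2) = a ∧ c * (-1 + d) = b := by
      intro a b h
      have hC' : 0 < 1 / 2 - C := by linarith
      have hpos : 0 < b ^ 2 / 2 - a := by
        rcases h with ⟨h1, h2, h3⟩ | ⟨h1, h2⟩
        · rcases h1.lt_or_eq with hb | rfl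
          · nlinarith [mul_pos hC' (pow_pos (neg_pos.2 hb) 2)]
          · have : a ≤ 0 := by simpa using h2
            have : a ≠ 0 := fun h => h3 (by rw [h])
            have : a < 0 := lt_of_le_of_ne ‹_› this
            linarith
        · nlinarith [mul_pos hC0 (pow_pos h1 2), pow_pos h1 2]
      -- Along an arc with `u = 1` the quantity `y² / 2 - x` is constant. It equals `1 / 2 - C` on
      -- the first arc of the spiral and scales with `c²`; then `d = 1 + b / c` matches the
      -- velocity.
      set c := √((b ^ 2 / 2 - a) / (1 / 2 - C)) with hcdef
      have hc : 0 < c := Real.sqrt_pos.2 (by positivity)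
      have hc2 : c ^ 2 * (1 / 2 - C) = b ^ 2 / 2 - a := by
        rw [hcdef, Real.sq_sqrt (by positivity), div_mul_cancel₀ _ hC'.ne']
      clear_value c
      have hbc : c * (b / c) = b := by field_simp
      refine ⟨c, 1 + b / c, hc, ?_, ?_, ?_, by linear_combination hbc⟩
      · rcases h with ⟨h1, h2, h3⟩ | ⟨h1, h2⟩
        · have : -b ≤ c := by
            refine abs_le_of_sq_le_sq' ?_ hc.le |>.2
            have : (-b) ^ 2 * (1 / 2 - C) ≤ c ^ 2 * (1 / 2 - C) := by rw [hc2]; nlinarith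
            exact le_of_mul_le_mul_right this hC'
          have : -1 ≤ b / c := by rw [le_div_iff₀ hc]; linarith
          linarith
        · positivity
      · have : b < r * c := by
          rcases h with ⟨h1, h2, h3⟩ | ⟨h1, h2⟩
          · exact h1.trans_lt (by positivity)
          · refine lt_of_pow_lt_pow_left₀ 2 (by positivity) ?_
            have h5 : r ^ 2 * (1 / 2 + C) = 1 / 2 - C := by linear_combination hrC
            have h4 : b ^ 2 * (1 / 2 + C) < (r * c) ^ 2 * (1 / 2 + C) := by
              have : (r * c) ^ 2 * (1 / 2 + C) = b ^ 2 / 2 - a := by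
                rw [← hc2, ← h5]; ring
              rw [this]; nlinarith
            exact lt_of_mul_lt_mul_right h4 (by linarith)
        have : b / c < r := by rw [div_lt_iff₀ hc]; linarith
        linarith
      · generalize b / c = z at hbc
        subst hbc
        linear_combination (-1) * hc2
    by_cases h1 : (b ≤ 0 ∧ a ≤ C * b ^ 2) ∨ (0 < b ∧ a < -(C * b ^ 2))
    · obtain ⟨c, d, h2, h3, h4, h5, h6⟩ := key a b (h1.imp (fun h => ⟨h.1, h.2, h0⟩) id)
      exact ⟨1, c, d, Or.inl rfl, h2, h3, h4, by rw [one_mul]; exact h5, by rw [one_mul]; exact h6⟩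
    · push Not at h1
      obtain ⟨c, d, h2, h3, h4, h5, h6⟩ := key (-a) (-b) (by
        rcases lt_trichotomy b 0 with hb | rfl | hb
        · right
          have := h1.1 hb.le
          exact ⟨by linarith, by rw [neg_sq]; linarith⟩
        · left
          have := h1.1 le_rfl
          refine ⟨by simp, by rw [neg_sq]; nlinarith, ?_⟩
          intro h
          have : a = 0 := by simpa using h
          exact h0 (by rw [this])
        · left
          have := h1.2 hb
          refine ⟨by linarith, by rw [neg_sq]; linarith, ?_⟩
          intro h
          have : b = 0 := by simpa using (Prod.mk.inj h).2
          linarith)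
      exact ⟨-1, c, d, Or.inr rfl, h2, h3, h4, by linear_combination (-1) * h5,
        by linear_combination (-1) * h6⟩
  have hsT : ∀ k, s k < T := fun k =>
    (hsm (Nat.lt_succ_self k)).trans_le (hsm.monotone.ge_of_tendsto hst _)
  have hdT : d < T := by have := hsT 1; rw [hs1] at this; linarith
  have halt : AlternatesTo (fun t => σ * p.u (d + t / c)) (c * (T - d)) := by
    -- The switching `s 0 = 0 ≤ d` is not in the future of the starting point. Dropping it shifts
    -- the index by one and flips the sign to `-σ`.
    refine ⟨fun k => c * (s (k + 1) - d), -σ, ?_, ?_, fun k => ⟨?_, ?_⟩, ?_, fun k t ht => ?_⟩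
    · rcases hσ with rfl | rfl <;> simp
    · intro i j hij
      have := hsm (Nat.add_lt_add_right hij 1)
      exact mul_lt_mul_of_pos_left (by linarith) hc
    · have := hsm.monotone (Nat.le_add_left 1 k)
      exact mul_pos hc (by rw [hs1] at this; linarith)
    · exact mul_lt_mul_of_pos_left (by linarith [hsT (k + 1)]) hc
    · exact ((hst.comp (tendsto_add_atTop_nat 1)).sub_const d).const_mul c
    · have : d + t / c ∈ Ico (s (k + 1)) (s (k + 1 + 1)) := by
        have h1 : s (k + 1) - d ≤ t / c := by rw [le_div_iff₀ hc]; linarith [ht.1]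
        have h2 : t / c < s (k + 1 + 1) - d := by rw [div_lt_iff₀ hc]; linarith [ht.2]
        exact ⟨by linarith, by linarith⟩
      simp only [hu _ _ this]
      ring
  obtain ⟨hy, hx⟩ := hxy d ⟨hd0, hd1.le⟩
  refine ⟨c * (T - d), _, _, _, ?_, ?_, ?_, hp.rescale hσ hc hd0,
    IsExtremal.rescale_restsFrom hrest hc, Or.inr halt, fun _ => halt⟩
  · exact mul_nonneg hc.le (by linarith)
  · simp [hx, ha]
  · simp [hy, hb]

/-! ### From extremals to optimality and uniqueness -/

theorem IsTrajectory.mono {S S' : Set ℝ} {a b : ℝ} {q : Path} (h : IsTrajectory S a b q)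
    (hS : S' ⊆ S) : IsTrajectory S' a b q where
  aestronglyMeasurable := h.aestronglyMeasurable.mono_measure (Measure.restrict_mono_set _ hS)
  abs_le_one := ae_restrict_of_ae_restrict_of_subset hS h.abs_le_one
  x_eq t ht := h.x_eq t (hS ht)
  y_eq t ht := h.y_eq t (hS ht)

theorem lintegral_Icc_sq_div_two {f : ℝ → ℝ} {L : ℝ} (hL : 0 ≤ L) (hf : ContinuousOn f (Icc 0 L)) :
    ∫⁻ t in Icc 0 L, ENNReal.ofReal (f t ^ 2 / 2) =
      ENNReal.ofReal ((∫ t in (0 : ℝ)..L, f t ^ 2) / 2) := by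
  rw [← intervalIntegral.integral_div, intervalIntegral.integral_of_le hL,
    ← integral_Icc_eq_integral_Ioc, ofReal_integral_eq_lintegral_ofReal]
  · exact ContinuousOn.integrableOn_compact isCompact_Icc (by fun_prop)
  · exact Eventually.of_forall fun t => by positivity

theorem le_infCost {q : Path} {L : ℝ} (hL : 0 ≤ L) (hq : ContinuousOn q.x (Icc 0 L)) :
    ENNReal.ofReal ((∫ t in (0 : ℝ)..L, q.x t ^ 2) / 2) ≤ infCost q := by
  rw [← lintegral_Icc_sq_div_two hL hq]
  exact lintegral_mono_set Icc_subset_Ici_self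

theorem infCost_le {p : Path} {P Q : ℝ → ℝ} {T L : ℝ} (hL : 0 ≤ L) (hTL : T ≤ L)
    (hp : ContinuousOn p.x (Icc 0 L)) (hr : RestsFrom T p P Q) :
    infCost p ≤ ENNReal.ofReal ((∫ t in (0 : ℝ)..L, p.x t ^ 2) / 2) := by
  rw [← lintegral_Icc_sq_div_two hL hp, infCost, ← Icc_union_Ici_eq_Ici hL]
  refine (lintegral_union_le _ _ _).trans_eq ?_
  have : ∫⁻ t in Ici L, ENNReal.ofReal (p.x t ^ 2 / 2) = 0 := by
    rw [setLIntegral_congr_fun (g := fun _ => 0) measurableSet_Ici fun t ht => by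
      simp [(hr t (hTL.trans ht)).1]]
    simp
  rw [this, add_zero]

/-- At `T` both adjoint variables vanish, so competitors need no terminal condition. After `T` the
extremal costs nothing, so comparing on `[0, T]` suffices. -/
theorem IsExtremal.isOptimal {p : Path} {P Q : ℝ → ℝ} {T : ℝ}
    (hp : IsExtremal (Ici 0) p P Q) (hT : 0 ≤ T) (hr : RestsFrom T p P Q) :
    IsOptimal (p.x 0) (p.y 0) p := by
  refine ⟨hp.isTrajectory _, fun q hq => ?_⟩
  have hq' : IsTrajectory (Icc 0 T) (p.x 0) (p.y 0) q := hq.mono Icc_subset_Ici_self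
  have h := (hp.mono Icc_subset_Ici_self).integral_sq_add_le hT hq'
    (by simp [(hr T le_rfl).2.2.2])
  have h0 : 0 ≤ ∫ t in (0 : ℝ)..T, (q.x t - p.x t) ^ 2 :=
    intervalIntegral.integral_nonneg hT fun t _ => sq_nonneg _
  refine (infCost_le hT le_rfl hp.continuous_x.continuousOn hr).trans
    (le_trans ?_ (le_infCost hT (hp.continuousOn_x_of_isTrajectory hq')))
  exact ENNReal.ofReal_le_ofReal (by linarith)

theorem IsExtremal.same_of_isOptimal {p q : Path} {P Q : ℝ → ℝ} {T : ℝ}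
    (hp : IsExtremal (Ici 0) p P Q) (hr : RestsFrom T p P Q)
    (hq : IsOptimal (p.x 0) (p.y 0) q) : Same (Ici 0) q p := by
  have key : ∀ L, 0 < L → T ≤ L → Same (Icc 0 L) q p := by
    intro L hL hTL
    have hq' : IsTrajectory (Icc 0 L) (p.x 0) (p.y 0) q := hq.1.mono Icc_subset_Ici_self
    have hle := (le_infCost hL.le (hp.continuousOn_x_of_isTrajectory hq')).trans
      ((hq.2 p (hp.isTrajectory _)).trans
        (infCost_le hL.le hTL hp.continuous_x.continuousOn hr))
    have h0 : 0 ≤ ∫ t in (0 : ℝ)..L, p.x t ^ 2 :=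
      intervalIntegral.integral_nonneg hL.le fun t _ => sq_nonneg _
    rw [ENNReal.ofReal_le_ofReal_iff (by positivity)] at hle
    exact (hp.mono Icc_subset_Ici_self).same_of_integral_sq_le hL hq'
      (by simp [(hr L hTL).2.2.2]) (by linarith)
  refine ⟨fun t ht => ?_, ?_⟩
  · refine (key (max t (max T 1)) ?_ ?_).1 t ⟨ht, le_max_left _ _⟩
    · exact lt_of_lt_of_le one_pos ((le_max_right _ _).trans (le_max_right _ _))
    · exact (le_max_left _ _).trans (le_max_right _ _)
  · have h1 : ∀ᵐ t, ∀ n : ℕ, t ∈ Icc 0 (max T 1 + n) → q.u t = p.u t := by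
      rw [ae_all_iff]
      intro n
      rw [← ae_restrict_iff' measurableSet_Icc]
      have hn : (0 : ℝ) ≤ n := n.cast_nonneg
      exact (key _ (by linarith [le_max_right T 1]) (by linarith [le_max_left T 1])).2
    rw [ae_restrict_iff' measurableSet_Ici]
    filter_upwards [h1] with t ht ht0
    obtain ⟨n, hn⟩ := exists_nat_ge t
    exact ht n ⟨ht0, by linarith [le_max_right T 1]⟩

/-- By uniqueness all optimal paths have the same rest times, so the infimum is taken over those of
a single path. -/
theorem arrivalTime_eq {a b T : ℝ} {p : Path} (hp : IsOptimal a b p)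
    (huniq : ∀ q, IsOptimal a b q → Same (Ici 0) q p) (hT : IsLeast (restTimes p) T) :
    arrivalTime a b = T := by
  have : {T | ∃ p : Path, IsOptimal a b p ∧ T ∈ restTimes p} = restTimes p := by
    ext T'
    refine ⟨fun ⟨q, hq, h0, hT'⟩ => ⟨h0, fun t ht => ?_⟩, fun h => ⟨p, hp, h⟩⟩
    have := (huniq q hq).1 t (h0.trans ht)
    rw [← this.1, ← this.2]
    exact hT' t ht
  rw [arrivalTime, this, hT.csInf_eq]

/-- Here the terminal term vanishes because competitors share the end point, whatever the adjoint
values are. -/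
theorem IsExtremal.isOptimalOn {p : Path} {P Q : ℝ → ℝ} {L : ℝ} (hL : 0 ≤ L)
    (hp : IsExtremal (Icc 0 L) p P Q) :
    IsOptimalOn L (p.x 0) (p.y 0) (p.x L) (p.y L) p := by
  refine ⟨⟨hp.isTrajectory _, rfl, rfl⟩, fun q ⟨hq, hx, hy⟩ => ?_⟩
  have h := hp.integral_sq_add_le hL hq (by simp [hx, hy])
  have h0 : 0 ≤ ∫ t in (0 : ℝ)..L, (q.x t - p.x t) ^ 2 :=
    intervalIntegral.integral_nonneg hL fun t _ => sq_nonneg _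
  linarith

theorem IsExtremal.same_of_isOptimalOn {p q : Path} {P Q : ℝ → ℝ} {L : ℝ} (hL : 0 < L)
    (hp : IsExtremal (Icc 0 L) p P Q)
    (hq : IsOptimalOn L (p.x 0) (p.y 0) (p.x L) (p.y L) q) : Same (Icc 0 L) q p :=
  hp.same_of_integral_sq_le hL hq.1.1 (by simp [hq.1.2.1, hq.1.2.2])
    (by linarith [hq.2 p ⟨hp.isTrajectory _, rfl, rfl⟩])

theorem same_of_eq {S : Set ℝ} (hS : MeasurableSet S) {p q : Path}
    (h : ∀ t ∈ S, p.x t = q.x t ∧ p.y t = q.y t ∧ p.u t = q.u t) : Same S p q :=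
  ⟨fun t ht => ⟨(h t ht).1, (h t ht).2.1⟩,
    (ae_restrict_iff' hS).2 (Eventually.of_forall fun t ht => (h t ht).2.2)⟩

end Fuller

/-! ### The finite-horizon theorem -/

theorem mainTheorem7 (x₀ y₀ x₁ y₁ t₁ : ℝ) (ht₁ : 0 < t₁)
    (h : Fuller.arrivalTime x₀ y₀ + Fuller.arrivalTime x₁ (-y₁) ≤ t₁) :
    ∃ pA pB pF : Fuller.Path,
      -- the optimal infinite-horizon trajectories and their arrival times
      (Fuller.IsOptimal x₀ y₀ pA ∧
        (∀ q, Fuller.IsOptimal x₀ y₀ q → Fuller.Same (Set.Ici 0) q pA) ∧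
        IsLeast (Fuller.restTimes pA) (Fuller.arrivalTime x₀ y₀)) ∧
      (Fuller.IsOptimal x₁ (-y₁) pB ∧
        (∀ q, Fuller.IsOptimal x₁ (-y₁) q → Fuller.Same (Set.Ici 0) q pB) ∧
        IsLeast (Fuller.restTimes pB) (Fuller.arrivalTime x₁ (-y₁))) ∧
      -- existence and uniqueness on `[0, t₁]`
      Fuller.IsOptimalOn t₁ x₀ y₀ x₁ y₁ pF ∧
      (∀ q, Fuller.IsOptimalOn t₁ x₀ y₀ x₁ y₁ q → Fuller.Same (Set.Icc 0 t₁) q pF) ∧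
      -- the structure of the optimal trajectory
      Fuller.Same (Set.Icc 0 (Fuller.arrivalTime x₀ y₀)) pF pA ∧
      Fuller.Same (Set.Icc (Fuller.arrivalTime x₀ y₀) (t₁ - Fuller.arrivalTime x₁ (-y₁)))
        pF Fuller.rest ∧
      Fuller.Same (Set.Icc (t₁ - Fuller.arrivalTime x₁ (-y₁)) t₁) pF (Fuller.reverse t₁ pB) ∧
      -- chattering
      ((x₀, y₀) ≠ (0, 0) → Fuller.ChattersLeft pF.u 0 (Fuller.arrivalTime x₀ y₀)) ∧
      ((x₁, y₁) ≠ (0, 0) →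
        Fuller.ChattersRight pF.u (t₁ - Fuller.arrivalTime x₁ (-y₁)) t₁) := by
  open Fuller in
  obtain ⟨T, pA, PA, QA, hT, hxA, hyA, hA, hrA, haltA, hchA⟩ := exists_isExtremal x₀ y₀
  obtain ⟨T', pB, PB, QB, hT', hxB, hyB, hB, hrB, haltB, hchB⟩ := exists_isExtremal x₁ (-y₁)
  have hoptA : IsOptimal x₀ y₀ pA := by
    have := hA.isOptimal hT hrA
    rwa [hxA, hyA] at this
  have hoptB : IsOptimal x₁ (-y₁) pB := by
    have := hB.isOptimal hT' hrB
    rwa [hxB, hyB] at this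
  have huniqA : ∀ q, IsOptimal x₀ y₀ q → Same (Ici 0) q pA := fun q hq =>
    hA.same_of_isOptimal hrA (by rwa [hxA, hyA])
  have huniqB : ∀ q, IsOptimal x₁ (-y₁) q → Same (Ici 0) q pB := fun q hq =>
    hB.same_of_isOptimal hrB (by rwa [hxB, hyB])
  have hleastA := hA.restsFrom_isLeast hT hrA haltA
  have hleastB := hB.restsFrom_isLeast hT' hrB haltB
  rw [arrivalTime_eq hoptA huniqA hleastA, arrivalTime_eq hoptB huniqB hleastB] at *
  have hF := hA.add_reverse hrA hB hrB h
  set pF : Path := ⟨fun t => pA.x t + pB.x (t₁ - t), fun t => pA.y t - pB.y (t₁ - t),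
    fun t => pA.u t + pB.u (t₁ - t)⟩ with hpF
  -- At either end of `[0, t₁]` the other summand is already at rest, so the superposition has the
  -- prescribed boundary values.
  have hL1 := hrA t₁ (by linarith)
  have hL2 := hrB t₁ (by linarith)
  have e1 : pF.x 0 = x₀ := by simp [pF, hxA, hL2.1]
  have e2 : pF.y 0 = y₀ := by simp [pF, hyA, hL2.2.1]
  have e3 : pF.x t₁ = x₁ := by simp [pF, hxB, hL1.1]
  have e4 : pF.y t₁ = y₁ := by simp [pF, hyB, hL1.2.1]
  have hFopt := hF.isOptimalOn ht₁.le
  have hFuniq := fun q => hF.same_of_isOptimalOn (q := q) ht₁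
  rw [e1, e2, e3, e4] at hFopt hFuniq
  refine ⟨pA, pB, pF, ⟨hoptA, huniqA, hleastA⟩, ⟨hoptB, huniqB, hleastB⟩, hFopt, hFuniq,
    same_of_eq measurableSet_Icc fun t ht => ?_, same_of_eq measurableSet_Icc fun t ht => ?_,
    same_of_eq measurableSet_Icc fun t ht => ?_, fun h0 => ?_, fun h0 => ?_⟩
  · have := hrB (t₁ - t) (by linarith [ht.2])
    simp [pF, this]
  · have h1 := hrB (t₁ - t) (by linarith [ht.2])
    have h2 := hrA t ht.1
    simp [pF, rest, h1, h2]
  · have h2 := hrA t (by linarith [ht.1])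
    simp [pF, reverse, h2]
  · refine (hchA h0).chattersLeft fun t ht => ?_
    have := hrB (t₁ - t) (by linarith [ht.2])
    simp [pF, this]
  · refine (hchB fun h1 => h0 ?_).chattersRight fun t ht => ?_
    · simpa using h1
    · have := hrA (t₁ - t) (by linarith [ht.2])
      simp [pF, this]
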